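/- Let $\langle a,b,c\rangle$ be the free group on $a,b,c$, and write $x^y=y^{-1}xy$ and $b_i=b^{c^i}$ for $i\in\mathbb Z$. A subgroup $H$ of a finitely generated group $G$ is called *benign* in $G$ if $G$ can be embedded in a finitely presented group $K$ that has a finitely generated subgroup $L$ with $G\cap L=H$. For an integer $m$ let $\xi_m,\xi'_m$ be the injective endomorphisms of $\langle b,c\rangle$ given by $\xi_m(b)=b_{-m+1}$, $\xi'_m(b)=b_{-m}$, $\xi_m(c)=\xi'_m(c)=c^2$, and let $$\Xi_m=\big\langle b,c,t_m,t'_m \;\big|\; g^{t_m}=\xi_m(g),\ g^{t'_m}=\xi'_m(g)\ \text{ for all } g\in\langle b,c\rangle\big\rangle$$ be the corresponding HNN-extension of $\langle b,c\rangle$ with stable letters $t_m,t'_m$. Let $$K_J=\big(\Xi_m *_{\langle b_m,t_m,t'_m\rangle}u\big)\,*_{\langle b,c\rangle}\,\big(\Xi_0*_{\langle b_{-1},t_0,t'_0\rangle}v\big)$$ be the free product, amalgamated along $\langle b,c\rangle$ (for $m=0$, of two copies with separate stable letters), of the HNN-extensions of $\Xi_m$ and $\Xi_0$ by stable letters $u$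 and $v$ that fix the indicated subgroups elementwise. Put $L_J=\big\langle\langle b,c\rangle^u,\langle b,c\rangle^v\big\rangle\le K_J$. Then for every integer $m\ge 0$ the subgroup $$J=\langle \ldots,b_{-2},b_{-1};\; b_m,b_{m+1},\ldots\rangle$$ is benign in $\langle b,c\rangle$ and in $\langle a,b,c\rangle$. More precisely: 1. $K_J$ is finitely presented, the natural map $\langle b,c\rangle\to K_J$ is injective, $L_J$ is generated by the four elements $b^u,c^u,b^v,c^v$, and $\langle b,c\rangle\cap L_J=J$ in $K_J$. 2. $\langle a\rangle * K_J$ is finitely presented, the natural map $\langle a,b,c\rangle\to\langle a\rangle*K_J$ is injective, and $\langle a,b,c\rangle\cap L_J=J$ in $\langle a\rangle*K_J$. 3. The subgroup $\big\langle\langle b,c\rangle,u,v\big\rangle$ of $K_J$ is the HNN-extension $\langle b,c\rangle*_{\langle b_m,b_{m+1},\ldots\rangle,\ \langle b_{-1},b_{-2},\ldots\rangle}(u,v)$ of $\langle b,c\rangle$ in which $u$ fixes $\langle b_m,b_{m+1},\ldots\rangle$ and $v$ fixes $\langle b_{-1},b_{-2},\ldots\rangle$ elementwise. -/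

import Mathlib

noncomputable section

namespace BenignStar

open Monoid

universe u v w

/-! ### Benign subgroups -/

/-- The group `K`, the embedding `e : G → K` and the subgroup `L ≤ K` witness that the subgroup
`H` of `G` is benign: `K` is finitely presented, `L` is finitely generated, and, with `G`
identified with its image in `K`, one has `G ∩ L = H`. -/
structure IsBenignWitness {G : Type u} [Group G] {K : Type v} [Group K]
    (e : G →* K) (L : Subgroup K) (H : Subgroup G) : Prop where
  finitelyPresented : Group.IsFinitelyPresented K
  injective : Function.Injective e
  fg : L.FG
  inter_eq : e.range ⊓ L = H.map e

/-- A subgroup `H` of a finitely generated group `G` is benign in `G` if `G` embeds in a finitely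
presented group `K` having a finitely generated subgroup `L` with `G ∩ L = H`. -/
def IsBenign {G : Type u} [Group G] [Group.FG G] (H : Subgroup G) : Prop :=
  ∃ (K : Type u) (_ : Group K) (e : G →* K) (L : Subgroup K), IsBenignWitness e L H

/-! ### HNN-extensions with several stable letters -/

section MultiHNN

variable {G : Type u} [Group G] {ι : Type v} {A B : ι → Subgroup G}

/-- The relators `t_i⁻¹ a t_i (φ_i a)⁻¹`, for `a ∈ A_i`, in the free product of `G` with the
free group on the letters `t_i`. -/
def multiHNNRelators (φ : ∀ i, A i ≃* B i) : Set (Coprod G (FreeGroup ι)) :=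
  {x | ∃ (i : ι) (a : A i),
    x = (Coprod.inr (FreeGroup.of i))⁻¹ * Coprod.inl (a : G) * Coprod.inr (FreeGroup.of i) *
      (Coprod.inl (φ i a : G))⁻¹}

/-- The HNN-extension `⟨G, t_i (i ∈ ι) | a ^ t_i = φ_i a for all a ∈ A_i, i ∈ ι⟩`, where
`x ^ y = y⁻¹ x y`. -/
def MultiHNN (φ : ∀ i, A i ≃* B i) : Type (max u v) :=
  Coprod G (FreeGroup ι) ⧸ Subgroup.normalClosure (multiHNNRelators φ)

instance (φ : ∀ i, A i ≃* B i) : Group (MultiHNN φ) :=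
  inferInstanceAs (Group (Coprod G (FreeGroup ι) ⧸ Subgroup.normalClosure (multiHNNRelators φ)))

/-- The canonical map of the base group. -/
def MultiHNN.of (φ : ∀ i, A i ≃* B i) : G →* MultiHNN φ :=
  (QuotientGroup.mk' (Subgroup.normalClosure (multiHNNRelators φ))).comp Coprod.inl

/-- The stable letters. -/
def MultiHNN.t (φ : ∀ i, A i ≃* B i) (i : ι) : MultiHNN φ :=
  QuotientGroup.mk' (Subgroup.normalClosure (multiHNNRelators φ)) (Coprod.inr (FreeGroup.of i))

/-- The HNN-extension `G *_{A_1, A_2, …} (t_1, t_2, …)` in which `t_i` fixes `A_i` elementwise. -/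
abbrev FixHNN (A : ι → Subgroup G) : Type (max u v) :=
  MultiHNN (fun i => MulEquiv.refl (A i))

end MultiHNN

/-! ### The star construction -/

section Star

variable {ι : Type w} {M : Type u} [Group M] {K : ι → Type v} [∀ i, Group (K i)]

/-- The star construction `✶_i (K_i, L_i, t_i)_M`: the HNN-extensions `K_i *_{L_i} t_i`, in which
the stable letter `t_i` fixes `L_i`, all amalgamated along `M` (which sits in `K_i` through the
map `j i`). -/
abbrev Star (j : ∀ i, M →* K i) (L : ∀ i, Subgroup (K i)) : Type (max u v w) :=
  PushoutI (fun i =>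
    (HNNExtension.of : K i →* HNNExtension (K i) (L i) (L i) (MulEquiv.refl (L i))).comp (j i))

/-- The map of the amalgamated group `M` to the star construction. -/
def Star.base (j : ∀ i, M →* K i) (L : ∀ i, Subgroup (K i)) : M →* Star j L :=
  PushoutI.base _

/-- The stable letters of the star construction. -/
def Star.t (j : ∀ i, M →* K i) (L : ∀ i, Subgroup (K i)) (i : ι) : Star j L :=
  PushoutI.of i (HNNExtension.t : HNNExtension (K i) (L i) (L i) (MulEquiv.refl (L i)))

end Star

/-! ### The elements `b_i` and the subgroups they generate -/

/-- `b_i = b ^ (c ^ i) = c⁻ⁱ b cⁱ`. -/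
def conjPow {G : Type u} [Group G] (b c : G) (i : ℤ) : G := c ^ (-i) * b * c ^ i

/-- The subgroup generated by the `b_i` with `i ∈ S`. -/
def conjPowSubgroup {G : Type u} [Group G] (b c : G) (S : Set ℤ) : Subgroup G :=
  Subgroup.closure (conjPow b c '' S)

/-- The subgroup `⟨…, b_{-2}, b_{-1}; b_m, b_{m+1}, …⟩`. -/
def J {G : Type u} [Group G] (b c : G) (m : ℤ) : Subgroup G :=
  conjPowSubgroup b c {i | i ≤ -1 ∨ m ≤ i}

/-- The free group `⟨b, c⟩` of rank two. -/
abbrev F₂ : Type := FreeGroup (Fin 2)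

/-- The generator `b` of `⟨b, c⟩`. -/
abbrev b₂ : F₂ := FreeGroup.of 0

/-- The generator `c` of `⟨b, c⟩`. -/
abbrev c₂ : F₂ := FreeGroup.of 1

/-- The free group `⟨a, b, c⟩` of rank three. -/
abbrev F₃ : Type := FreeGroup (Fin 3)

/-- The generator `b` of `⟨a, b, c⟩`; the generator `a` is `FreeGroup.of 0`. -/
abbrev b₃ : F₃ := FreeGroup.of 1

/-- The generator `c` of `⟨a, b, c⟩`. -/
abbrev c₃ : F₃ := FreeGroup.of 2

/-! ### The group `Ξ_m` -/

/-- The endomorphism `b ↦ b_k`, `c ↦ c²` of `⟨b, c⟩`. -/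
def xiHom (k : ℤ) : F₂ →* F₂ := FreeGroup.lift ![conjPow b₂ c₂ k, c₂ ^ 2]

/-- `(x, false) ↦ (x, true) ↦ (c x, false)`, a square root of left multiplication by `c`. -/
def rootPerm : Equiv.Perm (F₂ × Bool) where
  toFun p := match p with
    | (x, false) => (x, true)
    | (x, true) => (c₂ * x, false)
  invFun p := match p with
    | (x, true) => (x, false)
    | (x, false) => (c₂⁻¹ * x, true)
  left_inv := by rintro ⟨x, _ | _⟩ <;> simp
  right_inv := by rintro ⟨x, _ | _⟩ <;> simp

/-- Left multiplication of `⟨b, c⟩` on two copies of itself. -/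
def leftPerm : F₂ →* Equiv.Perm (F₂ × Bool) :=
  MonoidHom.mk' (fun g => (Equiv.mulLeft g).prodCongr (Equiv.refl Bool))
    (by intro g h; ext1 ⟨x, i⟩; simp [mul_assoc])

theorem leftPerm_injective : Function.Injective leftPerm := by
  intro g h hgh
  have := congrArg (fun p : Equiv.Perm (F₂ × Bool) => (p (1, false)).1) hgh
  simpa [leftPerm] using this

theorem xiHom_injective (k : ℤ) : Function.Injective (xiHom k) := by
  let ρ : F₂ →* Equiv.Perm (F₂ × Bool) := FreeGroup.lift ![leftPerm b₂, rootPerm]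
  have h : ((MulAut.conj (rootPerm ^ k)).toMonoidHom.comp ρ).comp (xiHom k) = leftPerm := by
    ext1 i
    fin_cases i
    · simp [ρ, xiHom, conjPow, mul_assoc, MulAut.conj_apply, -map_zpow]
      simp
    · have h2 : rootPerm ^ 2 = leftPerm c₂ := by
        ext1 ⟨x, i⟩
        cases i <;> simp [pow_two, rootPerm, leftPerm]
      have h3 : rootPerm ^ k * rootPerm ^ 2 * (rootPerm ^ k)⁻¹ = rootPerm ^ 2 := by
        group
      simpa [ρ, xiHom, h2, MulAut.conj_apply, -map_zpow] using h3
  have := leftPerm_injective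
  rw [← h, MonoidHom.coe_comp] at this
  exact this.of_comp

/-- The endomorphism `xiHom k` as an isomorphism of `⟨b, c⟩` onto its image. -/
def xiEquiv (k : ℤ) : (⊤ : Subgroup F₂) ≃* (xiHom k).range :=
  Subgroup.topEquiv.trans (MonoidHom.ofInjective (xiHom_injective k))

/-- The isomorphisms `ξ_m` (`b ↦ b_{-m+1}`, `c ↦ c²`) and `ξ'_m` (`b ↦ b_{-m}`, `c ↦ c²`). -/
def xi (m : ℤ) (i : Fin 2) : (⊤ : Subgroup F₂) ≃* (xiHom (![-m + 1, -m] i)).range :=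
  xiEquiv (![-m + 1, -m] i)

/-- `Ξ_m = ⟨b, c⟩ *_{ξ_m, ξ'_m} (t_m, t'_m)`. -/
abbrev Xi (m : ℤ) : Type := MultiHNN (xi m)

/-- The canonical map `⟨b, c⟩ → Ξ_m`. -/
def Xi.of (m : ℤ) : F₂ →* Xi m := MultiHNN.of (xi m)

/-- The subgroup `⟨b_n, t_m, t'_m⟩` of `Ξ_m`. -/
def XiL (m n : ℤ) : Subgroup (Xi m) :=
  Subgroup.closure {Xi.of m (conjPow b₂ c₂ n), MultiHNN.t (xi m) 0, MultiHNN.t (xi m) 1}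

/-! ### The groups `K_J` and `L_J` -/

/-- The two inclusions of `⟨b, c⟩` into `Ξ_m` and `Ξ_0`. -/
def inclJ (m : ℤ) (i : Fin 2) : F₂ →* Xi (![m, 0] i) := Xi.of (![m, 0] i)

/-- The subgroups `⟨b_m, t_m, t'_m⟩` of `Ξ_m` and `⟨b_{-1}, t_0, t'_0⟩` of `Ξ_0`. -/
def fixedJ (m : ℤ) (i : Fin 2) : Subgroup (Xi (![m, 0] i)) := XiL (![m, 0] i) (![m, -1] i)

/-- `K_J = (Ξ_m *_{⟨b_m, t_m, t'_m⟩} u) *_{⟨b, c⟩} (Ξ_0 *_{⟨b_{-1}, t_0, t'_0⟩} v)`. -/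
abbrev KJ (m : ℤ) : Type := Star (inclJ m) (fixedJ m)

/-- The canonical map `⟨b, c⟩ → K_J`. -/
def KJ.base (m : ℤ) : F₂ →* KJ m := Star.base (inclJ m) (fixedJ m)

/-- The stable letter `u` of `K_J`. -/
def KJ.u (m : ℤ) : KJ m := Star.t (inclJ m) (fixedJ m) 0

/-- The stable letter `v` of `K_J`. -/
def KJ.v (m : ℤ) : KJ m := Star.t (inclJ m) (fixedJ m) 1

/-- `L_J = ⟨⟨b, c⟩ ^ u, ⟨b, c⟩ ^ v⟩`. -/
def LJ (m : ℤ) : Subgroup (KJ m) :=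
  Subgroup.closure
    (Set.range (fun g : F₂ => (KJ.u m)⁻¹ * KJ.base m g * KJ.u m) ∪
      Set.range (fun g : F₂ => (KJ.v m)⁻¹ * KJ.base m g * KJ.v m))

/-- The subgroups `⟨b_m, b_{m+1}, …⟩` and `⟨b_{-1}, b_{-2}, …⟩` of `⟨b, c⟩`. -/
def sidesJ (m : ℤ) : Fin 2 → Subgroup F₂ :=
  ![conjPowSubgroup b₂ c₂ {i | m ≤ i}, conjPowSubgroup b₂ c₂ {i | i ≤ -1}]

/-- The overgroup `⟨a⟩ * K_J`, with `⟨a⟩` infinite cyclic. -/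
abbrev AKJ (m : ℤ) : Type := Coprod (Multiplicative ℤ) (KJ m)

/-- The canonical map `⟨a, b, c⟩ → ⟨a⟩ * K_J`. -/
def AKJ.base (m : ℤ) : F₃ →* AKJ m :=
  FreeGroup.lift ![Coprod.inl (Multiplicative.ofAdd 1), Coprod.inr (KJ.base m b₂),
    Coprod.inr (KJ.base m c₂)]

/-- `L_J` as a subgroup of `⟨a⟩ * K_J`. -/
def ALJ (m : ℤ) : Subgroup (AKJ m) := (LJ m).map Coprod.inr

end BenignStar

end

open BenignStar

/-! The point is the formula `ξ(b_i) = b_{2i+k}` for the endomorphism `b ↦ b_k`, `c ↦ c²`.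
Conjugation by `t_m` and `t'_m` thus acts on indices by `i ↦ 2i - m + 1` and `i ↦ 2i - m`. Starting
from `m` these maps reach every index `≥ m`, and an index is `≥ m` exactly when its images are. With
`m = 0` and start `-1` the same holds for the indices `≤ -1`. Hence `⟨b_m, t_m, t'_m⟩` and `⟨b_{-1},
t_0, t'_0⟩` meet `⟨b, c⟩` exactly in the two sides of `J` (`of_mem_XiL_self_iff`,
`of_mem_XiL_zero_neg_one_iff`). The exactness rests on a general fact
(`MultiHNN.mem_of_of_mem_closure`): if every `φ_i` matches `A_i ∩ C` with `B_i ∩ C`, then `C` and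
the stable letters generate nothing new in the base group.

By normal forms, these intersections make the HNN-extension of `⟨b, c⟩` whose letters fix the two
sides embed in `K_J` (`fixHNNToKJ_injective`). There, a permutation action shows that the conjugates
of the base by the stable letters meet the base in the join of the fixed subgroups
(`of_mem_conjBase_iff`), which is `J`.

Finite presentability holds because all associated and amalgamated subgroups are finitely generated.
The passage to `⟨a, b, c⟩` uses the retraction killing `a`. -/

open BenignStar Monoid

/-! ### Normal forms and maps of amalgamated products -/

namespace Monoid.PushoutI

section Map

variable {ι : Type*} {G G' : ι → Type*} {H H' : Type*} [∀ i, Group (G i)] [∀ i, Group (G' i)]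
  [Group H] [Group H'] {φ : ∀ i, H →* G i} {φ' : ∀ i, H' →* G' i}

theorem exists_reduced (hφ : ∀ i, Function.Injective (φ i)) (x : PushoutI φ) :
    ∃ (h : H) (w : CoprodI.Word G), Reduced φ w ∧ x = base φ h * ofCoprodI w.prod := by
  classical
  obtain ⟨d⟩ := NormalWord.transversal_nonempty φ hφ
  set n := NormalWord.equiv (d := d) x with hn
  have hx : x = n.prod := by rw [hn]; exact (NormalWord.equiv.symm_apply_apply x).symm
  refine ⟨n.head, n.toWord, ?_, hx⟩
  rintro ⟨i, g⟩ hg hr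
  -- A letter lying both in the transversal and in the amalgamated subgroup represents the trivial
  -- coset, so it is `1`.
  have h1 : g = 1 := by
    have := (d.compl i).equiv_fst_eq_self_of_mem_of_one_mem (d.one_mem i) hr
    have h2 := (d.compl i).equiv_fst_eq_one_of_mem_of_one_mem (one_mem _) (n.normalized i g hg)
    rw [h2] at this
    exact (congrArg Subtype.val this).symm
  exact n.toWord.ne_one _ hg h1

/-- The map of pushouts induced by a map of diagrams. -/
def map (f : H →* H') (g : ∀ i, G i →* G' i) (hg : ∀ i, (g i).comp (φ i) = (φ' i).comp f) :
    PushoutI φ →* PushoutI φ' :=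
  lift (fun i => (of i).comp (g i)) ((base φ').comp f) fun i => by
    rw [MonoidHom.comp_assoc, hg, ← MonoidHom.comp_assoc, of_comp_eq_base]

variable {f : H →* H'} {g : ∀ i, G i →* G' i} (hg : ∀ i, (g i).comp (φ i) = (φ' i).comp f)

@[simp]
theorem map_of (i : ι) (x : G i) : map f g hg (of i x) = of i (g i x) := by simp [map]

@[simp]
theorem map_base (x : H) : map f g hg (base φ x) = base φ' (f x) := by simp [map]

/-- If the vertex maps reflect membership in the amalgamated subgroups, then the induced map of
pushouts reflects membership in the base group. -/
theorem mem_base_range_of_map_mem (hφ : ∀ i, Function.Injective (φ i))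
    (hφ' : ∀ i, Function.Injective (φ' i))
    (hr : ∀ i y, g i y ∈ (φ' i).range → y ∈ (φ i).range) {x : PushoutI φ}
    (hx : map f g hg x ∈ (base φ').range) : x ∈ (base φ).range := by
  obtain ⟨h, w, hw, rfl⟩ := exists_reduced hφ x
  -- Applying `g` to each letter keeps the word reduced, because `hr` moves no letter into the
  -- amalgamated subgroup. A reduced word with product in the base is empty, so `w` was empty.
  let w' : CoprodI.Word G' :=
    { toList := w.toList.map fun p => ⟨p.1, g p.1 p.2⟩
      ne_one := by
        intro l hl
        obtain ⟨p, hp, rfl⟩ := List.mem_map.1 hl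
        intro h1
        exact hw p hp (hr _ _ (by simp only at h1; rw [h1]; exact one_mem _))
      chain_ne := by
        rw [List.isChain_map]
        exact w.chain_ne }
  have hprod : map f g hg (ofCoprodI w.prod) = ofCoprodI w'.prod := by
    simp only [CoprodI.Word.prod, map_list_prod, List.map_map, w']
    refine congrArg List.prod (List.map_congr_left fun p _ => ?_)
    simp
  have hw' : Reduced φ' w' := by
    intro l hl
    obtain ⟨p, hp, rfl⟩ := List.mem_map.1 hl
    exact fun h2 => hw p hp (hr _ _ h2)
  have he : w' = .empty := hw'.eq_empty_of_mem_range hφ' (by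
    rw [map_mul, map_base, hprod] at hx
    exact ((base φ').range.mul_mem_cancel_left (MonoidHom.mem_range.2 ⟨_, rfl⟩)).1 hx)
  have he' : w.toList = [] := by
    have := congrArg CoprodI.Word.toList he
    simpa [w', CoprodI.Word.empty] using this
  exact ⟨h, by simp [CoprodI.Word.prod, he']⟩

theorem map_injective (hφ : ∀ i, Function.Injective (φ i))
    (hφ' : ∀ i, Function.Injective (φ' i)) (hf : Function.Injective f)
    (hr : ∀ i y, g i y ∈ (φ' i).range → y ∈ (φ i).range) :
    Function.Injective (map f g hg) := by
  rw [injective_iff_map_eq_one]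
  intro x hx
  obtain ⟨h, rfl⟩ := mem_base_range_of_map_mem hg hφ hφ' hr (x := x) (by rw [hx]; exact one_mem _)
  rw [map_base, ← map_one (base φ')] at hx
  rw [(injective_iff_map_eq_one f).1 hf h (by simpa using base_injective hφ' hx), map_one]

end Map

end Monoid.PushoutI

/-! ### Britton's lemma and maps of HNN-extensions -/

namespace HNNExtension

section Map

variable {G G' : Type*} [Group G] [Group G'] {A B : Subgroup G} {A' B' : Subgroup G'}
  {φ : A ≃* B} {φ' : A' ≃* B'}

/-- The map of HNN-extensions induced by a compatible map of base groups. -/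
def map (f : G →* G') (hf : ∀ a : A, ∃ h : f a ∈ A', (φ' ⟨f a, h⟩ : G') = f (φ a)) :
    HNNExtension G A B φ →* HNNExtension G' A' B' φ' :=
  lift (of.comp f) t fun a => by
    obtain ⟨h, e⟩ := hf a
    simp only [MonoidHom.comp_apply, ← e]
    exact t_mul_of ⟨f a, h⟩

variable {f : G →* G'} (hf : ∀ a : A, ∃ h : f a ∈ A', (φ' ⟨f a, h⟩ : G') = f (φ a))

@[simp]
theorem map_of (x : G) : map f hf (of x) = of (f x) := by simp [map]

@[simp]
theorem map_t : map f hf t = t := by simp [map]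

/-- If the map of base groups reflects membership in the associated subgroups, then the induced
map of HNN-extensions reflects membership in the base group. -/
theorem mem_of_range_of_map_mem (hA : ∀ x, f x ∈ A' → x ∈ A) (hB : ∀ x, f x ∈ B' → x ∈ B)
    {x : HNNExtension G A B φ} (hx : map f hf x ∈ (of : G' →* HNNExtension G' A' B' φ').range) :
    x ∈ (of : G →* HNNExtension G A B φ).range := by
  obtain ⟨d⟩ := NormalWord.TransversalPair.nonempty G A B
  obtain ⟨w, rfl⟩ : ∃ w : NormalWord.ReducedWord G A B, w.prod φ = x :=
    ⟨(NormalWord.equiv φ d x).toReducedWord, (NormalWord.equiv φ d).symm_apply_apply x⟩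
  have hu : ∀ (u : ℤˣ) x, f x ∈ toSubgroup A' B' u → x ∈ toSubgroup A B u := by
    intro u x
    rcases Int.units_eq_one_or u with rfl | rfl
    · exact hA x
    · exact hB x
  -- Reflection of the associated subgroups means that no pinch `t a t⁻¹` or `t⁻¹ b t` appears in
  -- the image word. Britton's lemma then leaves no stable letter.
  let w' : NormalWord.ReducedWord G' A' B' :=
    { head := f w.head
      toList := w.toList.map fun p => (p.1, f p.2)
      chain := by
        rw [List.isChain_map]
        exact w.chain.imp fun a b h h1 => h (hu _ _ h1) }
  have hprod : map f hf (w.prod φ) = w'.prod φ' := by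
    simp only [NormalWord.ReducedWord.prod, map_mul, map_of, map_list_prod, List.map_map, w']
    congr 2
    refine List.map_congr_left fun p _ => ?_
    simp
  have he := ReducedWord.toList_eq_nil_of_mem_of_range φ' w' (hprod ▸ hx)
  have he' : w.toList = [] := by simpa [w'] using he
  exact ⟨w.head, by simp [NormalWord.ReducedWord.prod, he']⟩

theorem map_injective (hinj : Function.Injective f) (hA : ∀ x, f x ∈ A' → x ∈ A)
    (hB : ∀ x, f x ∈ B' → x ∈ B) : Function.Injective (map f hf) := by
  rw [injective_iff_map_eq_one]
  intro x hx
  obtain ⟨h, rfl⟩ := mem_of_range_of_map_mem hf hA hB (x := x) (by rw [hx]; exact one_mem _)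
  rw [map_of, ← map_one of] at hx
  rw [(injective_iff_map_eq_one f).1 hinj h (by simpa using of_injective φ' hx), map_one]

end Map

end HNNExtension

/-! ### Universal property of HNN-extensions with several stable letters -/

namespace BenignStar.MultiHNN

variable {G : Type*} [Group G] {ι : Type*} {A B : ι → Subgroup G} {φ : ∀ i, A i ≃* B i}

theorem inv_t_mul_of_mul_t (i : ι) (a : A i) :
    (t φ i)⁻¹ * of φ a * t φ i = of φ (φ i a) := by
  have h : QuotientGroup.mk' (Subgroup.normalClosure (multiHNNRelators φ)) _ = 1 :=
    (QuotientGroup.eq_one_iff _).2 (Subgroup.subset_normalClosure ⟨i, a, rfl⟩)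
  rw [map_mul, map_mul, map_mul, map_inv, map_inv, mul_inv_eq_one] at h
  exact h

/-- The universal property of the HNN-extension with several stable letters. -/
def lift {P : Type*} [Group P] (f : G →* P) (s : ι → P)
    (h : ∀ i (a : A i), (s i)⁻¹ * f a * s i = f (φ i a)) : MultiHNN φ →* P :=
  QuotientGroup.lift _ (Coprod.lift f (FreeGroup.lift s)) <| by
    intro x hx
    refine (Subgroup.normalClosure_le_normal (N := (Coprod.lift f (FreeGroup.lift s)).ker)
      (s := multiHNNRelators φ) ?_) hx
    rintro _ ⟨i, a, rfl⟩
    simp [MonoidHom.mem_ker, h]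

section Lift

variable {P : Type*} [Group P] {f : G →* P} {s : ι → P}
  (h : ∀ i (a : A i), (s i)⁻¹ * f a * s i = f (φ i a))

@[simp]
theorem lift_of (g : G) : lift f s h (of φ g) = f g :=
  (QuotientGroup.lift_mk' _ _ _).trans (Coprod.lift_apply_inl _ _ _)

@[simp]
theorem lift_t (i : ι) : lift f s h (t φ i) = s i :=
  (QuotientGroup.lift_mk' _ _ _).trans <| (Coprod.lift_apply_inr _ _ _).trans FreeGroup.lift_apply_of

end Lift

@[ext]
theorem hom_ext {P : Type*} [Monoid P] {f g : MultiHNN φ →* P}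
    (hof : f.comp (of φ) = g.comp (of φ)) (ht : ∀ i, f (t φ i) = g (t φ i)) : f = g := by
  refine QuotientGroup.monoidHom_ext _ (Coprod.hom_ext hof (FreeGroup.ext_hom _ _ ht))

/-- The universal property yields a map into `S` whose composite with the inclusion fixes all
generators, hence is the identity. -/
theorem closure_eq_top :
    Subgroup.closure (Set.range (of φ) ∪ Set.range (t φ)) = ⊤ := by
  set S := Subgroup.closure (Set.range (of φ) ∪ Set.range (t φ)) with hS
  let f : MultiHNN φ →* S :=
    lift ((of φ).codRestrict S fun g => Subgroup.subset_closure (.inl ⟨g, rfl⟩))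
      (fun i => ⟨t φ i, Subgroup.subset_closure (.inr ⟨i, rfl⟩)⟩)
      (fun i a => Subtype.ext (inv_t_mul_of_mul_t i a))
  have hf : S.subtype.comp f = MonoidHom.id _ := by
    ext <;> simp [f]
  refine top_unique fun x _ => ?_
  have := DFunLike.congr_fun hf x
  exact (show S.subtype (f x) = x from this) ▸ (f x).2

end BenignStar.MultiHNN

/-! ### Finite presentability of HNN-extensions and amalgams -/

namespace Group.IsFinitelyPresented

/-- A quotient `K` of a finitely presented group `E` is finitely presented if the quotient of `E`
by finitely many relators that hold in `K` is a quotient of `K` under `E`. -/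
theorem of_comp_eq_mk {E K : Type*} [Group E] [Group K] [IsFinitelyPresented E] (π : E →* K)
    (hπ : Function.Surjective π) (R : Set E) (hR : R.Finite) (h1 : ∀ r ∈ R, π r = 1)
    (ρ : K →* E ⧸ Subgroup.normalClosure R)
    (hρ : ρ.comp π = QuotientGroup.mk' (Subgroup.normalClosure R)) : IsFinitelyPresented K := by
  refine of_surjective π hπ ⟨R, hR, le_antisymm (Subgroup.normalClosure_le_normal h1) ?_⟩
  intro x hx
  have := DFunLike.congr_fun hρ x
  rw [MonoidHom.comp_apply, MonoidHom.mem_ker.1 hx, map_one] at this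
  exact (QuotientGroup.eq_one_iff _).1 this.symm

/-- Relators for a finite generating set of `A` suffice: conjugation by the stable letter and `φ`
are homomorphisms on `A`, so agreement on generators is agreement everywhere. The next two results
use the same argument. -/
instance hnnExtension {G : Type*} [Group G] [IsFinitelyPresented G] {A B : Subgroup G}
    [hA : Group.FG A] (φ : A ≃* B) : IsFinitelyPresented (HNNExtension G A B φ) := by
  obtain ⟨S, hS⟩ := Group.fg_def.1 hA
  let τ : Coprod G (Multiplicative ℤ) := Coprod.inr (Multiplicative.ofAdd 1)
  let r : A → Coprod G (Multiplicative ℤ) := fun a =>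
    τ * Coprod.inl (a : G) * τ⁻¹ * (Coprod.inl (φ a : G))⁻¹
  let N := Subgroup.normalClosure (r '' S)
  have hN (a : A) : QuotientGroup.mk' N τ * QuotientGroup.mk' N (Coprod.inl (a : G)) =
      QuotientGroup.mk' N (Coprod.inl (φ a : G)) * QuotientGroup.mk' N τ := by
    rw [← mul_inv_eq_iff_eq_mul]
    refine DFunLike.congr_fun (f := ((MulAut.conj (QuotientGroup.mk' N τ)).toMonoidHom.comp
      ((QuotientGroup.mk' N).comp (Coprod.inl.comp A.subtype))))
      (g := (QuotientGroup.mk' N).comp (Coprod.inl.comp (B.subtype.comp φ.toMonoidHom)))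
      (MonoidHom.eq_of_eqOn_dense hS fun a ha => ?_) a
    have h := (QuotientGroup.eq_one_iff _).2
      (Subgroup.subset_normalClosure (Set.mem_image_of_mem r ha))
    change QuotientGroup.mk' N (r a) = 1 at h
    simp only [r] at h
    rw [map_mul, map_mul, map_mul, map_inv, map_inv, mul_inv_eq_one] at h
    exact h
  refine of_comp_eq_mk (Coprod.lift HNNExtension.of (zpowersHom _ HNNExtension.t)) ?_
    (r '' S) (S.finite_toSet.image r) ?_
    (HNNExtension.lift ((QuotientGroup.mk' N).comp Coprod.inl) (QuotientGroup.mk' N τ) hN) ?_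
  · intro x
    rw [← MonoidHom.mem_range]
    induction x using HNNExtension.induction_on with
    | of g => exact ⟨Coprod.inl g, by simp⟩
    | t => exact ⟨τ, by simp [τ]⟩
    | mul x y hx hy => exact mul_mem hx hy
    | inv x hx => exact inv_mem hx
  · rintro _ ⟨a, -, rfl⟩
    simp [r, τ, HNNExtension.t_mul_of]
  · refine Coprod.hom_ext ?_ ?_
    · ext g; simp; rfl
    · ext; simp [τ]; rfl

theorem multiHNN {G : Type*} [Group G] [IsFinitelyPresented G] {ι : Type*} [Finite ι]
    {A B : ι → Subgroup G} (hA : ∀ i, Group.FG (A i)) (φ : ∀ i, A i ≃* B i) :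
    IsFinitelyPresented (MultiHNN φ) := by
  choose S hS using fun i => Group.fg_def.1 (hA i)
  let τ : ι → Coprod G (FreeGroup ι) := fun i => Coprod.inr (FreeGroup.of i)
  let r : ∀ i, A i → Coprod G (FreeGroup ι) := fun i a =>
    (τ i)⁻¹ * Coprod.inl (a : G) * τ i * (Coprod.inl (φ i a : G))⁻¹
  let R : Set (Coprod G (FreeGroup ι)) := ⋃ i, r i '' S i
  let N := Subgroup.normalClosure R
  have hN (i : ι) (a : A i) : (QuotientGroup.mk' N (τ i))⁻¹ *
      QuotientGroup.mk' N (Coprod.inl (a : G)) * QuotientGroup.mk' N (τ i) =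
      QuotientGroup.mk' N (Coprod.inl (φ i a : G)) := by
    refine Eq.trans (by simp) (DFunLike.congr_fun
      (f := ((MulAut.conj (QuotientGroup.mk' N (τ i))⁻¹).toMonoidHom.comp
      ((QuotientGroup.mk' N).comp (Coprod.inl.comp (A i).subtype))))
      (g := (QuotientGroup.mk' N).comp (Coprod.inl.comp ((B i).subtype.comp (φ i).toMonoidHom)))
      (MonoidHom.eq_of_eqOn_dense (hS i) fun a ha => ?_) a)
    have hR : r i a ∈ R := Set.mem_iUnion.2 ⟨i, Set.mem_image_of_mem (r i) ha⟩
    have h := (QuotientGroup.eq_one_iff _).2 (Subgroup.subset_normalClosure hR)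
    change QuotientGroup.mk' N (r i a) = 1 at h
    simp only [r] at h
    rw [map_mul, map_mul, map_mul, map_inv, map_inv, mul_inv_eq_one] at h
    simpa using h
  refine of_comp_eq_mk (QuotientGroup.mk' _) (QuotientGroup.mk'_surjective _) R
    (Set.finite_iUnion fun i => (S i).finite_toSet.image (r i)) ?_
    (MultiHNN.lift ((QuotientGroup.mk' N).comp Coprod.inl) (fun i => QuotientGroup.mk' N (τ i)) hN)
    ?_
  · intro x hx
    obtain ⟨i, a, -, rfl⟩ := Set.mem_iUnion.1 hx
    exact (QuotientGroup.eq_one_iff _).2 (Subgroup.subset_normalClosure ⟨i, a, rfl⟩)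
  · refine Coprod.hom_ext ?_ ?_
    · ext g; exact MultiHNN.lift_of hN g
    · ext i; exact MultiHNN.lift_t hN i

theorem pushoutI {K : Fin 2 → Type*} [∀ i, Group (K i)] {M : Type*} [Group M] [hM : Group.FG M]
    (φ : ∀ i, M →* K i) (h0 : IsFinitelyPresented (K 0)) (h1 : IsFinitelyPresented (K 1)) :
    IsFinitelyPresented (PushoutI φ) := by
  obtain ⟨S, hS⟩ := Group.fg_def.1 hM
  let r : M → Coprod (K 0) (K 1) := fun a => Coprod.inl (φ 0 a) * (Coprod.inr (φ 1 a))⁻¹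
  let N := Subgroup.normalClosure (r '' S)
  have hN : (QuotientGroup.mk' N).comp (Coprod.inr.comp (φ 1)) =
      (QuotientGroup.mk' N).comp (Coprod.inl.comp (φ 0)) := by
    refine MonoidHom.eq_of_eqOn_dense hS fun a ha => ?_
    have h := (QuotientGroup.eq_one_iff _).2
      (Subgroup.subset_normalClosure (Set.mem_image_of_mem r ha))
    change QuotientGroup.mk' N (r a) = 1 at h
    simp only [r] at h
    rw [map_mul, map_inv, mul_inv_eq_one] at h
    exact h.symm
  refine of_comp_eq_mk (Coprod.lift (PushoutI.of (φ := φ) 0) (PushoutI.of (φ := φ) 1)) ?_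
    (r '' S) (S.finite_toSet.image r) ?_
    (PushoutI.lift (Fin.cons ((QuotientGroup.mk' N).comp Coprod.inl)
      (Fin.cons ((QuotientGroup.mk' N).comp Coprod.inr) finZeroElim))
      ((QuotientGroup.mk' N).comp (Coprod.inl.comp (φ 0))) ?_) ?_
  · intro x
    rw [← MonoidHom.mem_range]
    induction x using PushoutI.induction_on with
    | of i g =>
      fin_cases i
      · exact ⟨Coprod.inl g, Coprod.lift_apply_inl _ _ _⟩
      · exact ⟨Coprod.inr g, Coprod.lift_apply_inr _ _ _⟩
    | base h =>
      exact ⟨Coprod.inl (φ 0 h), (Coprod.lift_apply_inl _ _ _).trans (PushoutI.of_apply_eq_base φ 0 h)⟩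
    | mul x y hx hy => exact mul_mem hx hy
  · rintro _ ⟨a, -, rfl⟩
    simp [r, PushoutI.of_apply_eq_base]
  · intro i
    fin_cases i
    · rfl
    · exact hN
  · refine Coprod.hom_ext ?_ ?_
    · ext g; simp; rfl
    · ext g
      simp
      rfl

end Group.IsFinitelyPresented

namespace BenignStar

/-! ### The free basis `b_i` and the action of `ξ` on indices -/

section ConjPow

variable {G P : Type*} [Group G] [Group P]

@[simp]
theorem map_conjPow (f : G →* P) (b c : G) (i : ℤ) :
    f (conjPow b c i) = conjPow (f b) (f c) i := by
  simp [conjPow]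

theorem map_conjPowSubgroup (f : G →* P) (b c : G) (S : Set ℤ) :
    (conjPowSubgroup b c S).map f = conjPowSubgroup (f b) (f c) S := by
  rw [conjPowSubgroup, MonoidHom.map_closure, ← Set.image_comp]
  congr 2
  ext i
  simp

theorem conjPow_mem {b c : G} {S : Set ℤ} {i : ℤ} (hi : i ∈ S) :
    conjPow b c i ∈ conjPowSubgroup b c S :=
  Subgroup.subset_closure ⟨i, hi, rfl⟩

theorem conjPow_conjPow_sq (b c : G) (k i : ℤ) :
    conjPow (conjPow b c k) (c ^ 2) i = conjPow b c (2 * i + k) := by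
  have h (n : ℤ) : (c ^ 2) ^ n = c ^ (2 * n) := by rw [zpow_mul, zpow_ofNat]
  simp only [conjPow, h]
  rw [show -(2 * i + k) = 2 * -i + -k by ring, show 2 * i + k = k + 2 * i by ring, zpow_add,
    zpow_add]
  simp only [mul_assoc]

theorem xiHom_conjPow (k i : ℤ) :
    xiHom k (conjPow b₂ c₂ i) = conjPow b₂ c₂ (2 * i + k) := by
  rw [map_conjPow, ← conjPow_conjPow_sq]
  simp [xiHom]

/-- The shift of the generators of the free group on `ℤ`. -/
def shift : Multiplicative ℤ →* MulAut (FreeGroup ℤ) :=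
  zpowersHom _ (FreeGroup.freeGroupCongr (Equiv.addRight (-1)))

/-- The sign matches `c b_i c⁻¹ = b_{i-1}`, since the right factor of the semidirect product acts by
`x ↦ c x c⁻¹`. -/
theorem shift_of (n i : ℤ) : shift (Multiplicative.ofAdd n) (FreeGroup.of i) = FreeGroup.of (i - n) := by
  have h (j : ℤ) : shift (Multiplicative.ofAdd 1) (FreeGroup.of j) = FreeGroup.of (j - 1) := by
    simp [shift, sub_eq_add_neg]
  induction n with
  | zero => simp
  | succ n ih => rw [ofAdd_add, mul_comm, map_mul, MulAut.mul_apply, ih, h, sub_sub]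
  | pred n ih =>
    rw [← (shift (Multiplicative.ofAdd 1)).injective.eq_iff, h, ← MulAut.mul_apply, ← map_mul,
      ← ofAdd_add, show 1 + (-(n : ℤ) - 1) = -n by ring, ih]
    congr 1
    ring

/-- The homomorphism `x_i ↦ b_i`. -/
def conjPowHom : FreeGroup ℤ →* F₂ := FreeGroup.lift (conjPow b₂ c₂)

/-- The embedding `b ↦ x_0`, `c ↦ 1 ∈ ℤ` of `⟨b, c⟩` into the semidirect product. -/
def toSemidirect : F₂ →* FreeGroup ℤ ⋊[shift] Multiplicative ℤ :=
  FreeGroup.lift ![SemidirectProduct.inl (FreeGroup.of 0),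
    SemidirectProduct.inr (Multiplicative.ofAdd 1)]

theorem toSemidirect_conjPowHom (x : FreeGroup ℤ) :
    toSemidirect (conjPowHom x) = SemidirectProduct.inl x := by
  refine DFunLike.congr_fun (f := toSemidirect.comp conjPowHom) ?_ x
  ext1 i
  have h (n : ℤ) : (SemidirectProduct.inr (Multiplicative.ofAdd 1) :
      FreeGroup ℤ ⋊[shift] Multiplicative ℤ) ^ n =
      SemidirectProduct.inr (Multiplicative.ofAdd n) := by
    rw [← map_zpow, ← ofAdd_zsmul]; simp
  have h2 := SemidirectProduct.inl_aut (φ := shift) (Multiplicative.ofAdd (-i)) (FreeGroup.of 0)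
  rw [shift_of] at h2
  simp only [conjPowHom, MonoidHom.comp_apply, FreeGroup.lift_apply_of, map_conjPow]
  simp only [toSemidirect, FreeGroup.lift_apply_of, Matrix.cons_val_zero, Matrix.cons_val_one,
    conjPow, h]
  rw [sub_neg_eq_add, zero_add] at h2
  rw [h2, ← ofAdd_neg, neg_neg]

/-- The `b_i` are free generators, because the semidirect product sees them as the letters `x_i`. -/
theorem conjPowHom_injective : Function.Injective conjPowHom := by
  have : Function.Injective (toSemidirect.comp conjPowHom) := by
    intro x y h
    simpa [toSemidirect_conjPowHom, SemidirectProduct.inl_injective.eq_iff] using h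
  exact Function.Injective.of_comp (f := toSemidirect) this

/-- `toSemidirect` has a left inverse `ψ`. In particular, an element with `c`-exponent zero is a
word in the `b_i`. -/
theorem conjPowHom_left_mul_zpow (g : F₂) :
    conjPowHom (toSemidirect g).left * c₂ ^ (toSemidirect g).right.toAdd = g := by
  let ψ : FreeGroup ℤ ⋊[shift] Multiplicative ℤ →* F₂ :=
    SemidirectProduct.lift conjPowHom (zpowersHom _ c₂) <| by
      intro n
      ext1 i
      change conjPowHom (shift (Multiplicative.ofAdd n.toAdd) (FreeGroup.of i)) = _
      rw [shift_of]
      simp only [conjPowHom, FreeGroup.lift_apply_of, conjPow, MonoidHom.comp_apply,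
        MulEquiv.coe_toMonoidHom, MulAut.conj_apply, zpowersHom_apply]
      group
  have h : ψ.comp toSemidirect = MonoidHom.id _ := by
    ext1 i
    fin_cases i
    · simp [ψ, toSemidirect, conjPowHom, conjPow]
    · simp [ψ, toSemidirect]
  simpa [ψ, SemidirectProduct.lift] using DFunLike.congr_fun h g

theorem conjPowHom_mem_iff (S : Set ℤ) (x : FreeGroup ℤ) :
    conjPowHom x ∈ conjPowSubgroup b₂ c₂ S ↔ x ∈ Subgroup.closure (FreeGroup.of '' S) := by
  have h : conjPowSubgroup b₂ c₂ S = (Subgroup.closure (FreeGroup.of '' S)).map conjPowHom := by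
    rw [conjPowSubgroup, MonoidHom.map_closure, ← Set.image_comp]
    congr 2
    ext i
    simp [conjPowHom]
  rw [h]
  exact Subgroup.mem_map_iff_mem conjPowHom_injective

theorem right_toSemidirect_xiHom (k : ℤ) (g : F₂) :
    (toSemidirect (xiHom k g)).right = (toSemidirect g).right ^ 2 := by
  refine DFunLike.congr_fun (f := SemidirectProduct.rightHom.comp (toSemidirect.comp (xiHom k)))
    (g := (powMonoidHom 2).comp (SemidirectProduct.rightHom.comp toSemidirect)) ?_ g
  ext1 i
  fin_cases i
  · simp [xiHom, toSemidirect, conjPow]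
  · simp [xiHom, toSemidirect, pow_two]

theorem xiHom_mem_conjPowSubgroup_iff (k : ℤ) (S : Set ℤ) (g : F₂) :
    xiHom k g ∈ conjPowSubgroup b₂ c₂ S ↔ g ∈ conjPowSubgroup b₂ c₂ {i | 2 * i + k ∈ S} := by
  constructor
  · intro hg
    -- Since `ξ` doubles the `c`-exponent, `g` itself has exponent zero and lies in the free group
    -- on the `b_i`.
    have hr : (toSemidirect (xiHom k g)).right = 1 := by
      have h : conjPowSubgroup b₂ c₂ S ≤
          (SemidirectProduct.rightHom.comp toSemidirect).ker := by
        rw [conjPowSubgroup, Subgroup.closure_le]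
        rintro _ ⟨i, -, rfl⟩
        simp [MonoidHom.mem_ker, toSemidirect, conjPow]
      exact h hg
    rw [right_toSemidirect_xiHom] at hr
    replace hr : (toSemidirect g).right.toAdd = 0 := by
      have : 2 * (toSemidirect g).right.toAdd = 0 := by
        simpa using congrArg Multiplicative.toAdd hr
      omega
    have hgx := conjPowHom_left_mul_zpow g
    rw [hr, zpow_zero, mul_one] at hgx
    set x := (toSemidirect g).left
    let σ : FreeGroup ℤ →* FreeGroup ℤ := FreeGroup.map fun i => 2 * i + k
    -- A left inverse of `σ`: it undoes `i ↦ 2i + k` and kills the letters of the other parity, so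
    -- it carries words in `S` to words in the preimage of `S`.
    let κ : FreeGroup ℤ →* FreeGroup ℤ :=
      FreeGroup.lift fun i => if 2 ∣ i - k then FreeGroup.of ((i - k) / 2) else 1
    have hκ : κ (σ x) = x := by
      refine DFunLike.congr_fun (f := κ.comp σ) (g := MonoidHom.id _) ?_ x
      ext1 i
      simp [κ, σ]
    have hσ : xiHom k (conjPowHom x) = conjPowHom (σ x) := by
      refine DFunLike.congr_fun (f := (xiHom k).comp conjPowHom) (g := conjPowHom.comp σ) ?_ x
      ext1 i
      simp only [MonoidHom.comp_apply, conjPowHom, FreeGroup.lift_apply_of, xiHom_conjPow, σ,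
        FreeGroup.map.of]
    rw [← hgx, hσ, conjPowHom_mem_iff] at hg
    rw [← hgx, conjPowHom_mem_iff, ← hκ]
    have hle : Subgroup.closure (FreeGroup.of '' S) ≤
        (Subgroup.closure (FreeGroup.of '' {i | 2 * i + k ∈ S})).comap κ := by
      rw [Subgroup.closure_le]
      rintro _ ⟨i, hi, rfl⟩
      simp only [Subgroup.coe_comap, Set.mem_preimage, SetLike.mem_coe, κ, FreeGroup.lift_apply_of]
      split_ifs with hd
      · refine Subgroup.subset_closure ⟨_, ?_, rfl⟩
        change 2 * ((i - k) / 2) + k ∈ S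
        rw [Int.mul_ediv_cancel' hd, sub_add_cancel]
        exact hi
      · exact one_mem _
    exact hle hg
  · intro hg
    have hle : conjPowSubgroup b₂ c₂ {i | 2 * i + k ∈ S} ≤
        (conjPowSubgroup b₂ c₂ S).comap (xiHom k) := by
      rw [conjPowSubgroup, Subgroup.closure_le]
      rintro _ ⟨i, hi, rfl⟩
      rw [SetLike.mem_coe, Subgroup.mem_comap, xiHom_conjPow]
      exact conjPow_mem hi
    exact hle hg

end ConjPow

/-! ### Subgroups generated by part of the base and the stable letters -/

namespace MultiHNN

variable {G : Type*} [Group G] {ι : Type*} {A B : ι → Subgroup G} (φ : ∀ i, A i ≃* B i)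

/-- The comparison of the HNN-extension with several stable letters with the HNN-extensions with
one stable letter, amalgamated along the base group. -/
def toPushoutI : MultiHNN φ →* PushoutI fun i =>
    (HNNExtension.of : G →* HNNExtension G (B i) (A i) (φ i).symm) :=
  lift (PushoutI.base _) (fun i => PushoutI.of i HNNExtension.t) fun i a => by
    -- In `HNNExtension` the letter acts by `t x t⁻¹`, while here `t⁻¹ a t = φ a`; so `t` carries `B
    -- i` to `A i` by the inverse of `φ i`.
    have h := HNNExtension.of_mul_t (φ := (φ i).symm) a
    rw [MulEquiv.symm_symm] at h
    rw [mul_assoc, inv_mul_eq_iff_eq_mul]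
    simp only [← PushoutI.of_apply_eq_base _ i, ← map_mul, h]

@[simp]
theorem toPushoutI_of (g : G) : toPushoutI φ (of φ g) = PushoutI.base _ g := by
  simp [toPushoutI]

@[simp]
theorem toPushoutI_t (i : ι) : toPushoutI φ (t φ i) = PushoutI.of i HNNExtension.t := by
  simp [toPushoutI]

theorem toPushoutI_injective : Function.Injective (toPushoutI φ) := by
  let ψ : (PushoutI fun i => (HNNExtension.of : G →* HNNExtension G (B i) (A i) (φ i).symm)) →*
      MultiHNN φ :=
    PushoutI.lift (fun i => HNNExtension.lift (of φ) (t φ i) fun b => by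
      have h := inv_t_mul_of_mul_t (φ := φ) i ((φ i).symm b)
      rw [MulEquiv.apply_symm_apply, mul_assoc, inv_mul_eq_iff_eq_mul] at h
      exact h.symm) (of φ) fun i => by ext; simp
  have h : ψ.comp (toPushoutI φ) = MonoidHom.id _ := by
    ext <;> simp [ψ]
  exact Function.LeftInverse.injective (g := ψ) (DFunLike.congr_fun h)

theorem of_injective : Function.Injective (of φ) := by
  have h := PushoutI.base_injective fun i => HNNExtension.of_injective (φ i).symm
  intro x y hxy
  apply h
  simp only [← toPushoutI_of, hxy]

/-- The isomorphism of associated subgroups of `C` induced by an isomorphism `A ≃* B` that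
preserves and reflects membership in `C`. -/
def subgroupOfEquiv {A B : Subgroup G} (φ : A ≃* B) (C : Subgroup G)
    (hC : ∀ a : A, (a : G) ∈ C ↔ (φ a : G) ∈ C) : A.subgroupOf C ≃* B.subgroupOf C where
  toFun x := ⟨⟨φ ⟨x, x.2⟩, (hC _).1 x.1.2⟩, (φ ⟨x, x.2⟩).2⟩
  invFun y := ⟨⟨φ.symm ⟨y, y.2⟩, (hC _).2 (by simp)⟩, (φ.symm ⟨y, y.2⟩).2⟩
  left_inv x := by
    have h := congrArg Subtype.val (φ.symm_apply_apply ⟨x, x.2⟩)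
    exact Subtype.ext (Subtype.ext h)
  right_inv y := by
    have h := congrArg Subtype.val (φ.apply_symm_apply ⟨y, y.2⟩)
    exact Subtype.ext (Subtype.ext h)
  map_mul' x y := by
    have h := congrArg Subtype.val (φ.map_mul ⟨x, x.2⟩ ⟨y, y.2⟩)
    exact Subtype.ext (Subtype.ext h)

variable {φ}

/-- If each `φ i` maps `A i ∩ C` onto `B i ∩ C`, then the subgroup generated by `C` and the stable
letters meets the base group in `C`. -/
theorem mem_of_of_mem_closure {C : Subgroup G}
    (hC : ∀ i (a : A i), (a : G) ∈ C ↔ (φ i a : G) ∈ C) {g : G}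
    (hg : of φ g ∈ Subgroup.closure (of φ '' C ∪ Set.range (t φ))) : g ∈ C := by
  let ψ (i : ι) := subgroupOfEquiv (φ i).symm C fun b => by
    rw [hC, MulEquiv.apply_symm_apply]
  have hψ (i : ι) (b : (B i).subgroupOf C) : ∃ h : C.subtype b ∈ B i,
      ((φ i).symm ⟨C.subtype b, h⟩ : G) = C.subtype (ψ i b) := ⟨b.2, rfl⟩
  let μ := PushoutI.map (φ := fun i => HNNExtension.of (φ := ψ i))
    (φ' := fun i => HNNExtension.of (φ := (φ i).symm)) C.subtype
    (fun i => HNNExtension.map C.subtype (hψ i)) fun i => by ext; simp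
  -- `μ` maps the HNN-extension of `C` along the restricted isomorphisms onto a subgroup containing
  -- `C` and all stable letters.
  have hle : Subgroup.closure (of φ '' C ∪ Set.range (t φ)) ≤ μ.range.comap (toPushoutI φ) := by
    rw [Subgroup.closure_le]
    rintro _ (⟨c, hc, rfl⟩ | ⟨i, rfl⟩)
    · exact ⟨PushoutI.base _ ⟨c, hc⟩, by simp [μ]⟩
    · exact ⟨PushoutI.of i HNNExtension.t, by simp [μ]⟩
  obtain ⟨y, hy⟩ := hle hg
  rw [toPushoutI_of] at hy
  -- The associated subgroups of `C` are preimages of those of `G`, so reflection of membership is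
  -- automatic at both levels.
  obtain ⟨c, rfl⟩ := PushoutI.mem_base_range_of_map_mem (x := y) _
    (fun i => HNNExtension.of_injective (ψ i)) (fun i => HNNExtension.of_injective (φ i).symm)
    (fun i y hy => HNNExtension.mem_of_range_of_map_mem (hψ i) (fun _ h => h) (fun _ h => h) hy)
    (hy ▸ ⟨g, rfl⟩ : μ y ∈ _)
  rw [PushoutI.map_base] at hy
  rw [← PushoutI.base_injective (fun i => HNNExtension.of_injective (φ i).symm) hy]
  exact c.2

end MultiHNN

/-! ### Intersections with `⟨b, c⟩` inside `Ξ_m` -/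

section Xi

theorem Xi.of_injective (m : ℤ) : Function.Injective (Xi.of m) := MultiHNN.of_injective _

theorem coe_xi (m : ℤ) (i : Fin 2) (g : (⊤ : Subgroup F₂)) :
    (xi m i g : F₂) = xiHom (![-m + 1, -m] i) g := rfl

/-- By `h0` and `h1` the index maps preserve and reflect `S`, so no element of `⟨b, c⟩` outside the
span of the `b_i`, `i ∈ S`, can arise; `hS` gives the other inclusion. -/
theorem of_mem_XiL_iff {m n : ℤ} {S : Set ℤ} (hS : ∀ k ∈ S, Xi.of m (conjPow b₂ c₂ k) ∈ XiL m n)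
    (hn : n ∈ S) (h0 : ∀ i, 2 * i + (-m + 1) ∈ S ↔ i ∈ S) (h1 : ∀ i, 2 * i + -m ∈ S ↔ i ∈ S)
    (g : F₂) : Xi.of m g ∈ XiL m n ↔ g ∈ conjPowSubgroup b₂ c₂ S := by
  constructor
  · intro hg
    refine MultiHNN.mem_of_of_mem_closure (φ := xi m) ?_ (Subgroup.closure_mono ?_ hg)
    · intro i a
      rw [coe_xi, xiHom_mem_conjPowSubgroup_iff]
      fin_cases i
      · simp [h0]
      · simp [h1]
    · rintro _ (rfl | rfl | rfl)
      · exact .inl ⟨_, conjPow_mem hn, rfl⟩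
      · exact .inr ⟨0, rfl⟩
      · exact .inr ⟨1, rfl⟩
  · intro hg
    have hle : conjPowSubgroup b₂ c₂ S ≤ (XiL m n).comap (Xi.of m) := by
      rw [conjPowSubgroup, Subgroup.closure_le]
      rintro _ ⟨i, hi, rfl⟩
      exact hS i hi
    exact hle hg

theorem of_conjPow_mem_XiL_succ {m n k : ℤ} (h : Xi.of m (conjPow b₂ c₂ k) ∈ XiL m n) :
    Xi.of m (conjPow b₂ c₂ (2 * k + (-m + 1))) ∈ XiL m n := by
  have ht : MultiHNN.t (xi m) 0 ∈ XiL m n := Subgroup.subset_closure (.inr (.inl rfl))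
  rw [← xiHom_conjPow]
  exact (MultiHNN.inv_t_mul_of_mul_t (φ := xi m) 0 ⟨conjPow b₂ c₂ k, trivial⟩) ▸
    mul_mem (mul_mem (inv_mem ht) h) ht

theorem of_conjPow_mem_XiL_two_mul {m n k : ℤ} (h : Xi.of m (conjPow b₂ c₂ k) ∈ XiL m n) :
    Xi.of m (conjPow b₂ c₂ (2 * k + -m)) ∈ XiL m n := by
  have ht : MultiHNN.t (xi m) 1 ∈ XiL m n := Subgroup.subset_closure (.inr (.inr rfl))
  rw [← xiHom_conjPow]
  exact (MultiHNN.inv_t_mul_of_mul_t (φ := xi m) 1 ⟨conjPow b₂ c₂ k, trivial⟩) ▸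
    mul_mem (mul_mem (inv_mem ht) h) ht

theorem of_conjPow_self_mem_XiL (m n : ℤ) : Xi.of m (conjPow b₂ c₂ n) ∈ XiL m n :=
  Subgroup.subset_closure (.inl rfl)

/-- Binary descent: from `m + l` the two letters produce `m + 2l` and `m + 2l + 1`, and every `j >
0` is `2l` or `2l + 1` with `l < j`. -/
theorem of_mem_XiL_self_iff (m : ℤ) (g : F₂) :
    Xi.of m g ∈ XiL m m ↔ g ∈ conjPowSubgroup b₂ c₂ {i | m ≤ i} := by
  refine of_mem_XiL_iff (S := {i | m ≤ i}) ?_ (by simp) (fun i => ?_) (fun i => ?_) g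
  · have h (j : ℕ) : Xi.of m (conjPow b₂ c₂ (m + j)) ∈ XiL m m := by
      induction j using Nat.strong_induction_on with
      | _ j ih =>
        obtain rfl | hj := Nat.eq_zero_or_pos j
        · simpa using of_conjPow_self_mem_XiL m m
        obtain ⟨l, rfl | rfl⟩ := Nat.even_or_odd' j
        · convert! of_conjPow_mem_XiL_two_mul (ih l (by omega)) using 3
          push_cast; ring
        · convert! of_conjPow_mem_XiL_succ (ih l (by omega)) using 3
          push_cast; ring
    intro k hk
    obtain ⟨j, rfl⟩ := Int.le.dest hk
    exact h j
  · change m ≤ _ ↔ m ≤ i; omega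
  · change m ≤ _ ↔ m ≤ i; omega

/-- The mirror image: `-1 - l` goes to `-1 - 2l` under `t_0` and to `-1 - (2l + 1)` under `t'_0`. -/
theorem of_mem_XiL_zero_neg_one_iff (g : F₂) :
    Xi.of 0 g ∈ XiL 0 (-1) ↔ g ∈ conjPowSubgroup b₂ c₂ {i | i ≤ -1} := by
  refine of_mem_XiL_iff (S := {i | i ≤ -1}) ?_ (by simp) (fun i => ?_) (fun i => ?_) g
  · have h (j : ℕ) : Xi.of 0 (conjPow b₂ c₂ (-1 - j)) ∈ XiL 0 (-1) := by
      induction j using Nat.strong_induction_on with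
      | _ j ih =>
        obtain rfl | hj := Nat.eq_zero_or_pos j
        · simpa using of_conjPow_self_mem_XiL 0 (-1)
        obtain ⟨l, rfl | rfl⟩ := Nat.even_or_odd' j
        · convert! of_conjPow_mem_XiL_succ (ih l (by omega)) using 3
          push_cast; ring
        · convert! of_conjPow_mem_XiL_two_mul (ih l (by omega)) using 3
          push_cast; ring
    intro k hk
    obtain ⟨j, hj⟩ := Int.le.dest hk
    convert! h j using 3
    omega
  · change _ ≤ (-1 : ℤ) ↔ i ≤ -1; omega
  · change _ ≤ (-1 : ℤ) ↔ i ≤ -1; omega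

end Xi

/-! ### The HNN-extension of `⟨b, c⟩` inside `K_J` -/

section Star

variable (m : ℤ)

theorem inclJ_injective (i : Fin 2) : Function.Injective (inclJ m i) := Xi.of_injective _

theorem star_inclJ_injective (i : Fin 2) : Function.Injective
    ((HNNExtension.of : _ →* HNNExtension _ (fixedJ m i) (fixedJ m i) (MulEquiv.refl _)).comp
      (inclJ m i)) :=
  (HNNExtension.of_injective _).comp (inclJ_injective m i)

theorem KJ.base_injective : Function.Injective (KJ.base m) :=
  PushoutI.base_injective (star_inclJ_injective m)

theorem inclJ_mem_fixedJ_iff (i : Fin 2) (g : F₂) : inclJ m i g ∈ fixedJ m i ↔ g ∈ sidesJ m i := by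
  fin_cases i
  · exact of_mem_XiL_self_iff m g
  · exact of_mem_XiL_zero_neg_one_iff g

theorem sidesJ_le_J (i : Fin 2) : sidesJ m i ≤ J b₂ c₂ m := by
  fin_cases i
  · exact Subgroup.closure_mono (Set.image_mono fun _ h => .inr h)
  · exact Subgroup.closure_mono (Set.image_mono fun _ h => .inl h)

theorem J_le_iSup_sidesJ : J b₂ c₂ m ≤ ⨆ i, sidesJ m i := by
  rw [J, conjPowSubgroup, Subgroup.closure_le]
  rintro _ ⟨i, hi | hi, rfl⟩
  · exact Subgroup.mem_iSup_of_mem 1 (conjPow_mem (S := {i | i ≤ -1}) hi)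
  · exact Subgroup.mem_iSup_of_mem 0 (conjPow_mem (S := {i | m ≤ i}) hi)

theorem hnn_inclJ_compat (i : Fin 2) (a : sidesJ m i) : ∃ h : inclJ m i a ∈ fixedJ m i,
    (MulEquiv.refl (fixedJ m i) ⟨inclJ m i a, h⟩ : Xi _) =
      inclJ m i ((MulEquiv.refl (sidesJ m i)).symm a) :=
  ⟨(inclJ_mem_fixedJ_iff m i a).2 a.2, rfl⟩

/-- The map to `K_J` of the HNN-extensions of `⟨b, c⟩` with one stable letter, amalgamated along
`⟨b, c⟩`. -/
noncomputable def sidesToKJ : (PushoutI fun i => (HNNExtension.of : F₂ →*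
    HNNExtension F₂ (sidesJ m i) (sidesJ m i) (MulEquiv.refl (sidesJ m i)).symm)) →* KJ m :=
  PushoutI.map (MonoidHom.id F₂) (fun i => HNNExtension.map (inclJ m i) (hnn_inclJ_compat m i))
    fun i => MonoidHom.ext fun x => HNNExtension.map_of (hnn_inclJ_compat m i) x

theorem sidesToKJ_injective : Function.Injective (sidesToKJ m) := by
  refine PushoutI.map_injective _ (fun i => HNNExtension.of_injective _)
    (star_inclJ_injective m) Function.injective_id ?_
  rintro i y ⟨g, hg⟩
  -- The vertex map is injective, so an element whose image comes from `g ∈ ⟨b, c⟩` is the copy of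
  -- `g`.
  refine ⟨g, HNNExtension.map_injective (hnn_inclJ_compat m i) (inclJ_injective m i)
    (fun x => (inclJ_mem_fixedJ_iff m i x).1) (fun x => (inclJ_mem_fixedJ_iff m i x).1) ?_⟩
  rw [HNNExtension.map_of]
  exact hg

/-- The homomorphism of the HNN-extension of `⟨b, c⟩` to `K_J`. -/
noncomputable def fixHNNToKJ : FixHNN (sidesJ m) →* KJ m :=
  (sidesToKJ m).comp (MultiHNN.toPushoutI _)

@[simp]
theorem fixHNNToKJ_of (g : F₂) : fixHNNToKJ m (MultiHNN.of _ g) = KJ.base m g :=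
  (congrArg (sidesToKJ m) (MultiHNN.toPushoutI_of _ g)).trans (PushoutI.map_base _ g)

theorem fixHNNToKJ_t (i : Fin 2) :
    fixHNNToKJ m (MultiHNN.t _ i) = Star.t (inclJ m) (fixedJ m) i :=
  (congrArg (sidesToKJ m) (MultiHNN.toPushoutI_t _ i)).trans <|
    (PushoutI.map_of _ i _).trans <|
      congrArg (PushoutI.of i) (HNNExtension.map_t (hnn_inclJ_compat m i))

theorem fixHNNToKJ_injective : Function.Injective (fixHNNToKJ m) :=
  (sidesToKJ_injective m).comp (MultiHNN.toPushoutI_injective _)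

theorem range_fixHNNToKJ : (fixHNNToKJ m).range =
    Subgroup.closure (Set.range (KJ.base m) ∪ {KJ.u m, KJ.v m}) := by
  rw [MonoidHom.range_eq_map, ← MultiHNN.closure_eq_top, MonoidHom.map_closure, Set.image_union,
    ← Set.range_comp, ← Set.range_comp]
  congr 2
  ext x
  rw [Set.mem_range, Fin.exists_fin_two, Function.comp_apply, Function.comp_apply,
    fixHNNToKJ_t, fixHNNToKJ_t, eq_comm, @eq_comm _ _ x]
  rfl

end Star

/-! ### Conjugates of the base group by stable letters that fix subgroups -/

section FixHNN

variable {G : Type*} [Group G] {ι : Type*} (A : ι → Subgroup G)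

/-- The subgroup generated by the conjugates of the base group by the stable letters. -/
def conjBase : Subgroup (FixHNN A) :=
  Subgroup.closure (⋃ i, Set.range fun g : G =>
    (MultiHNN.t _ i)⁻¹ * MultiHNN.of _ g * MultiHNN.t _ i)

/-- The conjugates of the base group by the stable letters generate a subgroup that meets the base
group in the subgroup generated by the associated subgroups. -/
theorem of_mem_conjBase_iff {H : Subgroup G} (hH : H = ⨆ i, A i) (g : G) :
    MultiHNN.of _ g ∈ conjBase A ↔ g ∈ H := by
  classical
  constructor
  · intro hg
    -- `G` acts on its cosets together with an extra fixed point `none`; every stable letter acts by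
    -- swapping `none` with the trivial coset.
    let σ : Equiv.Perm (Option (G ⧸ H)) := Equiv.swap none (some ((1 : G) : G ⧸ H))
    let α : G →* Equiv.Perm (Option (G ⧸ H)) := MulAction.toPermHom G _
    have hfix (a : G) (ha : a ∈ H) : a • ((1 : G) : G ⧸ H) = (1 : G) := by
      rw [MulAction.Quotient.smul_coe, QuotientGroup.eq]
      simpa using ha
    let θ : FixHNN A →* Equiv.Perm (Option (G ⧸ H)) := MultiHNN.lift α (fun _ => σ) <| by
      intro i a
      have ha : (a : G) ∈ H := hH ▸ Subgroup.mem_iSup_of_mem i a.2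
      rw [mul_assoc, inv_mul_eq_iff_eq_mul]
      -- An element of `H` fixes both swapped points, so it commutes with the swap.
      have h := Equiv.swap_apply_apply (α (a : G)) none (some ((1 : G) : G ⧸ H))
      have h1 : α (a : G) none = none := rfl
      have h2 : α (a : G) (some ((1 : G) : G ⧸ H)) = some ((1 : G) : G ⧸ H) :=
        congrArg some (hfix a ha)
      rw [h1, h2] at h
      exact (eq_mul_inv_iff_mul_eq.1 h).symm
    -- A conjugate `t⁻¹ g t` takes the trivial coset to `none`, which `g` fixes, and back. An
    -- element of `G` fixing the trivial coset lies in `H`.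
    have hle : conjBase A ≤
        (MulAction.stabilizer (Equiv.Perm (Option (G ⧸ H))) (some ((1 : G) : G ⧸ H))).comap θ := by
      rw [conjBase, Subgroup.closure_le]
      intro x hx
      obtain ⟨i, g, rfl⟩ := Set.mem_iUnion.1 hx
      have h1 : σ (some ((1 : G) : G ⧸ H)) = none := Equiv.swap_apply_right _ _
      have h2 : σ.symm none = some ((1 : G) : G ⧸ H) := Equiv.swap_apply_left _ _
      have h3 : α g none = none := rfl
      simp [MulAction.mem_stabilizer_iff, θ, h1, h2, h3]
    have h := hle hg
    rw [Subgroup.mem_comap, MultiHNN.lift_of, MulAction.mem_stabilizer_iff] at h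
    have h' : g • ((1 : G) : G ⧸ H) = (1 : G) := Option.some_injective _ h
    rw [MulAction.Quotient.smul_coe, QuotientGroup.eq] at h'
    simpa using h'
  · intro hg
    have hle : H ≤ (conjBase A).comap (MultiHNN.of _) := by
      rw [hH, iSup_le_iff]
      intro i a ha
      have h := MultiHNN.inv_t_mul_of_mul_t (φ := fun i => MulEquiv.refl (A i)) i ⟨a, ha⟩
      exact Subgroup.mem_comap.2 (h ▸ Subgroup.subset_closure (Set.mem_iUnion.2 ⟨i, a, rfl⟩))
    exact hle hg

end FixHNN

/-! ### The witnesses `K_J` and `⟨a⟩ * K_J` -/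

section Witness

variable (m : ℤ)

theorem map_conjBase : (conjBase (sidesJ m)).map (fixHNNToKJ m) = LJ m := by
  rw [conjBase, MonoidHom.map_closure, LJ, Set.image_iUnion]
  congr 1
  ext x
  simp only [Set.mem_iUnion, Set.mem_image, Set.mem_range, exists_exists_eq_and, map_mul, map_inv,
    fixHNNToKJ_t, fixHNNToKJ_of, Fin.exists_fin_two, Set.mem_union]
  rfl

theorem base_mem_LJ_iff (g : F₂) : KJ.base m g ∈ LJ m ↔ g ∈ J b₂ c₂ m := by
  rw [← map_conjBase, ← fixHNNToKJ_of, Subgroup.mem_map_iff_mem (fixHNNToKJ_injective m)]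
  exact of_mem_conjBase_iff _ (le_antisymm (J_le_iSup_sidesJ m) (iSup_le (sidesJ_le_J m))) g

theorem range_inf_eq_map {G K : Type*} [Group G] [Group K] {e : G →* K} {L : Subgroup K}
    {H : Subgroup G} (h : ∀ g, e g ∈ L ↔ g ∈ H) : e.range ⊓ L = H.map e := by
  ext x
  constructor
  · rintro ⟨⟨g, rfl⟩, hg⟩
    exact ⟨g, (h g).1 hg, rfl⟩
  · rintro ⟨g, hg, rfl⟩
    exact ⟨⟨g, rfl⟩, (h g).2 hg⟩

theorem LJ_eq_closure : LJ m = Subgroup.closure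
    {(KJ.u m)⁻¹ * KJ.base m b₂ * KJ.u m, (KJ.u m)⁻¹ * KJ.base m c₂ * KJ.u m,
      (KJ.v m)⁻¹ * KJ.base m b₂ * KJ.v m, (KJ.v m)⁻¹ * KJ.base m c₂ * KJ.v m} := by
  apply le_antisymm
  · have key (x : KJ m) (L : Subgroup (KJ m)) (hb : x⁻¹ * KJ.base m b₂ * x ∈ L)
        (hc : x⁻¹ * KJ.base m c₂ * x ∈ L) (g : F₂) : x⁻¹ * KJ.base m g * x ∈ L := by
      have h : Subgroup.closure (Set.range FreeGroup.of) ≤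
          L.comap ((MulAut.conj x⁻¹).toMonoidHom.comp (KJ.base m)) := by
        rw [Subgroup.closure_le]
        rintro _ ⟨i, rfl⟩
        fin_cases i
        · simpa using hb
        · simpa using hc
      simpa using h (FreeGroup.closure_range_of (Fin 2) ▸ Subgroup.mem_top g)
    rw [LJ, Subgroup.closure_le]
    rintro _ (⟨g, rfl⟩ | ⟨g, rfl⟩)
    · exact key _ _ (Subgroup.subset_closure (by simp)) (Subgroup.subset_closure (by simp)) g
    · exact key _ _ (Subgroup.subset_closure (by simp)) (Subgroup.subset_closure (by simp)) g
  · refine Subgroup.closure_mono ?_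
    rintro _ (rfl | rfl | rfl | rfl)
    exacts [.inl ⟨_, rfl⟩, .inl ⟨_, rfl⟩, .inr ⟨_, rfl⟩, .inr ⟨_, rfl⟩]

theorem LJ_fg : (LJ m).FG := by
  rw [LJ_eq_closure, Subgroup.fg_iff]
  exact ⟨_, rfl, Set.toFinite _⟩

instance (m n : ℤ) : Group.FG (XiL m n) := by
  rw [Group.fg_iff_subgroup_fg, Subgroup.fg_iff]
  exact ⟨_, rfl, Set.toFinite _⟩

instance Xi.isFinitelyPresented : Group.IsFinitelyPresented (Xi m) := by
  refine Group.IsFinitelyPresented.multiHNN (fun _ => ?_) _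
  rw [Group.fg_iff_subgroup_fg]
  exact (Group.fg_def (G := F₂)).1 inferInstance

instance KJ.isFinitelyPresented : Group.IsFinitelyPresented (KJ m) :=
  Group.IsFinitelyPresented.pushoutI _
    (inferInstanceAs (Group.IsFinitelyPresented
      (HNNExtension (Xi m) (XiL m m) (XiL m m) (MulEquiv.refl _))))
    (inferInstanceAs (Group.IsFinitelyPresented
      (HNNExtension (Xi 0) (XiL 0 (-1)) (XiL 0 (-1)) (MulEquiv.refl _))))

theorem isBenignWitness_KJ : IsBenignWitness (KJ.base m) (LJ m) (J b₂ c₂ m) where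
  finitelyPresented := inferInstance
  injective := KJ.base_injective m
  fg := LJ_fg m
  inter_eq := range_inf_eq_map (base_mem_LJ_iff m)

/-- The inclusion of `⟨b, c⟩` into `⟨a, b, c⟩`. -/
def inclF₃ : F₂ →* F₃ := FreeGroup.lift ![b₃, c₃]

/-- The retraction of `⟨a, b, c⟩` onto `⟨b, c⟩` killing `a`. -/
def killA : F₃ →* F₂ := FreeGroup.lift ![1, b₂, c₂]

theorem AKJ.base_inclF₃ (g : F₂) : AKJ.base m (inclF₃ g) = Coprod.inr (KJ.base m g) := by
  refine DFunLike.congr_fun (f := (AKJ.base m).comp inclF₃) (g := Coprod.inr.comp (KJ.base m)) ?_ g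
  ext1 i
  fin_cases i <;> simp [AKJ.base, inclF₃]

theorem AKJ.snd_base (g : F₃) : Coprod.snd (AKJ.base m g) = KJ.base m (killA g) := by
  refine DFunLike.congr_fun (f := Coprod.snd.comp (AKJ.base m)) (g := (KJ.base m).comp killA) ?_ g
  ext1 i
  fin_cases i <;> simp [AKJ.base, killA]

/-- The map of `⟨a, b, c⟩` to the HNN-extension of `⟨b, c⟩` with stable letter `a` and trivial
associated subgroups. -/
def toHNNBot : F₃ →* HNNExtension F₂ ⊥ ⊥ (MulEquiv.refl _) :=
  FreeGroup.lift ![HNNExtension.t, HNNExtension.of b₂, HNNExtension.of c₂]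

theorem toHNNBot_injective : Function.Injective toHNNBot := by
  let ψ : HNNExtension F₂ ⊥ ⊥ (MulEquiv.refl _) →* F₃ :=
    HNNExtension.lift inclF₃ (FreeGroup.of 0) fun a => by
      have h : (a : F₂) = 1 := Subgroup.mem_bot.1 a.2
      simp [h]
  have h : ψ.comp toHNNBot = MonoidHom.id _ := by
    ext1 i
    fin_cases i <;> simp [ψ, toHNNBot, inclF₃]
  exact Function.LeftInverse.injective (g := ψ) (DFunLike.congr_fun h)

/-- Adjoining `a` freely is an HNN-extension over the trivial subgroup, so injectivity of `⟨b, c⟩ →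
K_J` carries over through `HNNExtension.map_injective`. -/
theorem AKJ.base_injective : Function.Injective (AKJ.base m) := by
  have hf (a : (⊥ : Subgroup F₂)) : ∃ h : KJ.base m a ∈ (⊥ : Subgroup (KJ m)),
      (MulEquiv.refl (⊥ : Subgroup (KJ m)) ⟨KJ.base m a, h⟩ : KJ m) =
        KJ.base m (MulEquiv.refl (⊥ : Subgroup F₂) a) :=
    ⟨by rw [Subgroup.mem_bot.1 a.2, map_one]; exact one_mem _, rfl⟩
  have hbot (x : F₂) (hx : KJ.base m x ∈ (⊥ : Subgroup (KJ m))) : x ∈ (⊥ : Subgroup F₂) :=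
    Subgroup.mem_bot.2 ((injective_iff_map_eq_one _).1 (KJ.base_injective m) x hx)
  let ψ : AKJ m →* HNNExtension (KJ m) ⊥ ⊥ (MulEquiv.refl _) :=
    Coprod.lift (zpowersHom _ HNNExtension.t) HNNExtension.of
  have h : ψ.comp (AKJ.base m) = (HNNExtension.map (KJ.base m) hf).comp toHNNBot := by
    ext1 i
    fin_cases i
    · simp [ψ, AKJ.base, toHNNBot, HNNExtension.map_t hf]
    · simp [ψ, AKJ.base, toHNNBot, HNNExtension.map_of hf]
    · simp [ψ, AKJ.base, toHNNBot, HNNExtension.map_of hf]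
  have hinj := (HNNExtension.map_injective hf (KJ.base_injective m) hbot hbot).comp
    toHNNBot_injective
  rw [← MonoidHom.coe_comp, ← h] at hinj
  exact Function.Injective.of_comp (f := ψ) hinj

theorem base_mem_ALJ_iff (g : F₃) : AKJ.base m g ∈ ALJ m ↔ g ∈ J b₃ c₃ m := by
  have hJ : (J b₂ c₂ m).map inclF₃ = J b₃ c₃ m := by
    rw [J, map_conjPowSubgroup]
    simp [inclF₃, J]
  rw [← hJ]
  constructor
  · rintro ⟨l, hl, hlg⟩
    -- Projecting to `K_J` kills `a` and fixes `L_J`; injectivity then forces `g` to equal its own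
    -- retract in `⟨b, c⟩`.
    have h : l = KJ.base m (killA g) := by
      rw [← AKJ.snd_base, ← hlg, Coprod.snd_apply_inr]
    refine ⟨killA g, (base_mem_LJ_iff m _).1 (h ▸ hl), AKJ.base_injective m ?_⟩
    rw [AKJ.base_inclF₃, ← h, hlg]
  · rintro ⟨x, hx, rfl⟩
    exact ⟨_, (base_mem_LJ_iff m x).2 hx, (AKJ.base_inclF₃ m x).symm⟩

theorem isBenignWitness_AKJ : IsBenignWitness (AKJ.base m) (ALJ m) (J b₃ c₃ m) where
  finitelyPresented := inferInstance
  injective := AKJ.base_injective m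
  fg := by
    rw [ALJ, LJ_eq_closure, MonoidHom.map_closure, Subgroup.fg_iff]
    exact ⟨_, rfl, (Set.toFinite _).image _⟩
  inter_eq := range_inf_eq_map (base_mem_ALJ_iff m)

end Witness

end BenignStar

open BenignStar
theorem mainTheorem11 (m : ℤ) (hm : 0 ≤ m) :
    -- `J` is benign in `⟨b, c⟩` and in `⟨a, b, c⟩`
    IsBenign (J b₂ c₂ m) ∧ IsBenign (J b₃ c₃ m) ∧
    -- as witnessed by `K_J` and `⟨a⟩ * K_J` with the subgroup `L_J`
    IsBenignWitness (KJ.base m) (LJ m) (J b₂ c₂ m) ∧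
    IsBenignWitness (AKJ.base m) (ALJ m) (J b₃ c₃ m) ∧
    -- `L_J` is generated by the four elements `b ^ u`, `c ^ u`, `b ^ v`, `c ^ v`
    LJ m = Subgroup.closure
      {(KJ.u m)⁻¹ * KJ.base m b₂ * KJ.u m, (KJ.u m)⁻¹ * KJ.base m c₂ * KJ.u m,
        (KJ.v m)⁻¹ * KJ.base m b₂ * KJ.v m, (KJ.v m)⁻¹ * KJ.base m c₂ * KJ.v m} ∧
    -- `⟨⟨b, c⟩, u, v⟩` is the HNN-extension of `⟨b, c⟩` in which `u` fixes `⟨b_m, b_{m+1}, …⟩`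
    -- and `v` fixes `⟨b_{-1}, b_{-2}, …⟩`
    ∃ f : FixHNN (sidesJ m) ≃*
        Subgroup.closure (Set.range (KJ.base m) ∪ {KJ.u m, KJ.v m}),
      (∀ g : F₂, (f (MultiHNN.of _ g) : KJ m) = KJ.base m g) ∧
      (f (MultiHNN.t _ 0) : KJ m) = KJ.u m ∧ (f (MultiHNN.t _ 1) : KJ m) = KJ.v m := by
  refine ⟨⟨_, _, _, _, isBenignWitness_KJ m⟩, ⟨_, _, _, _, isBenignWitness_AKJ m⟩,
    isBenignWitness_KJ m, isBenignWitness_AKJ m, LJ_eq_closure m,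
    (MonoidHom.ofInjective (fixHNNToKJ_injective m)).trans
      (MulEquiv.subgroupCongr (range_fixHNNToKJ m)), ?_, ?_, ?_⟩
  · exact fixHNNToKJ_of m
  · exact fixHNNToKJ_t m 0
  · exact fixHNNToKJ_t m 1
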